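/- **Theorem 4.2.** Let $\mathbb{K}$ be a field of characteristic zero and let $w=(w_1,\dots,w_n)$ be a weighting, i.e. integers $1\le w_1\le\cdots\le w_n$. For a multi-index $\alpha\in\mathbb{N}^n$ put $\langle w,\alpha\rangle=\sum_i w_i\alpha_i$, let $\mathcal{F}^k$ be the ideal of $\mathbb{K}[[x]]=\mathbb{K}[[x^1,\dots,x^n]]$ generated by the monomials $x^\alpha$ with $\langle w,\alpha\rangle\ge k$, and let $\mathcal{P}^k$ be the $\mathbb{K}$-span of the monomials $x^\alpha$ with $\langle w,\alpha\rangle=k$. A formal vector field is a $\mathbb{K}$-linear derivation $X$ of $\mathbb{K}[[x]]$; it is called $w$-admissible if $X(\mathcal{F}^l)\subseteq\mathcal{F}^l$ for all $l$. A formal vector field $Y$ is called quasi-homogeneous of weighted degree $k$ if $Y(\mathcal{P}^l)\subseteq\mathcal{P}^{l+k}$ for all $l$; equivalently, $Y$ is a $\mathbb{K}$-linear combination of the fields $x^\alpha\frac{\partial}{\partial x^i}$ with $\langle w,\alpha\rangle-w_i=k$. Let $\mathfrak{X}_{[k]}$ be the space of these fields. If $X=\sum_i X^i\frac{\partial}{\partial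 x^i}$ with $X^i=\sum_\alpha c^i_\alpha x^\alpha$, the weighted linear approximation of $X$ is $$X_{[0]}=\sum_i\Big(\sum_{\langle w,\alpha\rangle=w_i}c^i_\alpha x^\alpha\Big)\frac{\partial}{\partial x^i}\in\mathfrak{X}_{[0]}.$$ Let $X$ be a $w$-admissible formal vector field. Suppose that for every integer $k\ge 1$ the operator $\operatorname{ad}_{X_{[0]}}=[X_{[0]},\,\cdot\,]\colon\mathfrak{X}_{[k]}\to\mathfrak{X}_{[k]}$ is invertible, where $[Y,Z]=Y\circ Z-Z\circ Y$. Then there exists a formal diffeomorphism $\varphi$, i.e. a $\mathbb{K}$-algebra automorphism of $\mathbb{K}[[x]]$, such that $\varphi^*X=X_{[0]}$, where $\varphi^*X:=\varphi\circ X\circ\varphi^{-1}$. -/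

import Mathlib

open MvPowerSeries

noncomputable section

namespace FormalGeometry

/-- The algebra `K⟦x¹, …, xⁿ⟧` of formal functions on `Kⁿ`. -/
abbrev FormalFunction (K : Type*) [Field K] (n : ℕ) : Type _ := MvPowerSeries (Fin n) K

/-- Formal vector fields on `Kⁿ`: the `K`-linear derivations of `K⟦x¹, …, xⁿ⟧`, with Mathlib's
commutator Lie bracket `⁅X, Y⁆ = X ∘ Y - Y ∘ X`. -/
abbrev FormalVectorField (K : Type*) [Field K] (n : ℕ) : Type _ :=
  Derivation K (FormalFunction K n) (FormalFunction K n)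

/-- Formal diffeomorphisms of `Kⁿ`: the `K`-algebra automorphisms of `K⟦x¹, …, xⁿ⟧`. -/
abbrev FormalDiffeomorphism (K : Type*) [Field K] (n : ℕ) : Type _ :=
  FormalFunction K n ≃ₐ[K] FormalFunction K n

/-- The pullback `φ^* X = φ ∘ X ∘ φ⁻¹` of a formal vector field along a formal diffeomorphism. -/
def pullback {K : Type*} [Field K] {n : ℕ} (φ : FormalDiffeomorphism K n)
    (X : FormalVectorField K n) : FormalVectorField K n :=
  Derivation.mk' (φ.toLinearMap ∘ₗ X.toLinearMap ∘ₗ φ.symm.toLinearMap) fun f g => by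
    simp

/-- A weighting of `Kⁿ`: integers `1 ≤ w₁ ≤ ⋯ ≤ wₙ`. -/
structure Weighting (n : ℕ) where
  weight : Fin n → ℤ
  one_le : ∀ i, 1 ≤ weight i
  mono : Monotone weight

/-- The weighted degree `⟨w, α⟩ = ∑ i, wᵢ αᵢ` of the monomial `x^α`. -/
def Weighting.degree {n : ℕ} (w : Weighting n) (α : Fin n →₀ ℕ) : ℤ :=
  ∑ i, w.weight i * (α i : ℤ)

/-- The ideal `𝓕^k` generated by the monomials of weighted degree at least `k`. -/
def filt (K : Type*) [Field K] {n : ℕ} (w : Weighting n) (k : ℤ) : Ideal (FormalFunction K n) :=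
  Ideal.span {f | ∃ α : Fin n →₀ ℕ, k ≤ w.degree α ∧ f = monomial α (1 : K)}

/-- The formal vector fields that raise filtration degree by `k`. -/
def vfFilt (K : Type*) [Field K] {n : ℕ} (w : Weighting n) (k : ℤ) :
    Submodule (FormalFunction K n) (FormalVectorField K n) where
  carrier := {X | ∀ l : ℤ, ∀ f ∈ filt K w l, X f ∈ filt K w (l + k)}
  add_mem' hX hY l f hf := by
    simpa using Ideal.add_mem _ (hX l f hf) (hY l f hf)
  zero_mem' l f _ := by simp
  smul_mem' g X hX l f hf := by
    simpa using Ideal.mul_mem_left _ g (hX l f hf)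

/-- A formal vector field is `w`-admissible if it preserves the weighted filtration. -/
def IsAdmissible {K : Type*} [Field K] {n : ℕ} (w : Weighting n) (X : FormalVectorField K n) :
    Prop :=
  X ∈ vfFilt K w 0

/-- The space `𝓟^k ⊆ K[x] ⊆ K⟦x⟧` of quasi-homogeneous polynomials of weighted degree `k`,
spanned by the monomials of weighted degree `k`. -/
def quasiHomogeneous (K : Type*) [Field K] {n : ℕ} (w : Weighting n) (k : ℤ) :
    Submodule K (FormalFunction K n) :=
  Submodule.span K {f | ∃ α : Fin n →₀ ℕ, w.degree α = k ∧ f = monomial α (1 : K)}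

/-- The space of quasi-homogeneous polynomial vector fields of weighted degree `k`: those which
act on polynomials by raising gradation degree by `k`. Such a field maps `K[x]` to itself, so it
is a polynomial vector field. -/
def vfGrad (K : Type*) [Field K] {n : ℕ} (w : Weighting n) (k : ℤ) :
    Submodule K (FormalVectorField K n) where
  carrier := {X | ∀ l : ℤ, ∀ f ∈ quasiHomogeneous K w l, X f ∈ quasiHomogeneous K w (l + k)}
  add_mem' hX hY l f hf := by
    simpa using Submodule.add_mem _ (hX l f hf) (hY l f hf)
  zero_mem' l f _ := by simp
  smul_mem' c X hX l f hf := by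
    simpa using Submodule.smul_mem _ c (hX l f hf)

/-- The part of weighted degree `k` of a power series. -/
def component {K : Type*} [Field K] {n : ℕ} (w : Weighting n) (k : ℤ) (f : FormalFunction K n) :
    FormalFunction K n :=
  fun α => if w.degree α = k then coeff α f else 0

/-- The part `X_[k] = ∑ i, X_[k]ⁱ ∂/∂xⁱ` of weighted degree `k` of a formal vector field `X`, where
`X_[k]ⁱ` collects the monomials `x^α` of `Xⁱ = X(xⁱ)` with `⟨w, α⟩ - wᵢ = k`. -/
def vfComponent {K : Type*} [Field K] {n : ℕ} (w : Weighting n) (k : ℤ)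
    (X : FormalVectorField K n) : FormalVectorField K n :=
  ∑ i, component w (w.weight i + k) (X (MvPowerSeries.X i)) • pderiv K i

/-- The weighted linear approximation `X_[0]` of `X`. -/
def weightedLinearApprox {K : Type*} [Field K] {n : ℕ} (w : Weighting n)
    (X : FormalVectorField K n) : FormalVectorField K n :=
  vfComponent w 0 X

theorem Weighting.degree_add {n : ℕ} (w : Weighting n) (α β : Fin n →₀ ℕ) :
    w.degree (α + β) = w.degree α + w.degree β := by
  simp [Weighting.degree, mul_add, Finset.sum_add_distrib]

theorem Weighting.degree_single {n : ℕ} (w : Weighting n) (i : Fin n) :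
    w.degree (Finsupp.single i 1) = w.weight i := by
  classical
  simp [Weighting.degree, Finsupp.single_apply]

theorem Weighting.finite_degree_eq {n : ℕ} (w : Weighting n) (k : ℤ) :
    {α : Fin n →₀ ℕ | w.degree α = k}.Finite := by
  refine (Set.finite_Iic (Finsupp.equivFunOnFinite.symm fun _ : Fin n => k.toNat)).subset ?_
  intro α hα i
  have hα' : w.degree α = k := hα
  have h1 : w.weight i * (α i : ℤ) ≤ w.degree α :=
    Finset.single_le_sum (f := fun j => w.weight j * (α j : ℤ))
      (fun j _ => mul_nonneg (by linarith [w.one_le j]) (by positivity)) (Finset.mem_univ i)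
  have h2 : (α i : ℤ) ≤ w.weight i * (α i : ℤ) := by
    nlinarith [w.one_le i, Int.natCast_nonneg (α i)]
  have : (α i : ℤ) ≤ k := by linarith
  simp only [Finsupp.equivFunOnFinite_symm_apply_apply]
  omega

theorem mem_quasiHomogeneous_iff {K : Type*} [Field K] {n : ℕ} (w : Weighting n) (k : ℤ)
    (f : FormalFunction K n) :
    f ∈ quasiHomogeneous K w k ↔ ∀ α, coeff α f ≠ 0 → w.degree α = k := by
  classical
  constructor
  · intro hf
    induction hf using Submodule.span_induction with
    | mem f hf =>
      obtain ⟨β, hβ, rfl⟩ := hf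
      intro α hα
      rw [coeff_monomial] at hα
      split_ifs at hα with h
      · rw [h, hβ]
      · exact absurd rfl hα
    | zero => intro α hα; simp at hα
    | add f g _ _ hf hg =>
      intro α hα
      by_cases h : coeff α f = 0
      · exact hg α (by simpa [h] using hα)
      · exact hf α h
    | smul c f _ hf =>
      intro α hα
      refine hf α fun h => hα ?_
      simp [h]
  · intro hf
    have hsum : f = ∑ α ∈ (w.finite_degree_eq k).toFinset, coeff α f • monomial α (1 : K) := by
      ext β
      simp only [map_sum, coeff_smul, coeff_monomial, mul_ite, mul_one, mul_zero]
      rw [Finset.sum_ite_eq]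
      split_ifs with h
      · rfl
      · by_contra h'
        exact h (by simpa using hf β h')
    rw [hsum]
    refine Submodule.sum_mem _ fun α hα => Submodule.smul_mem _ _ (Submodule.subset_span ?_)
    exact ⟨α, by simpa using hα, rfl⟩

theorem component_mem {K : Type*} [Field K] {n : ℕ} (w : Weighting n) (k : ℤ)
    (f : FormalFunction K n) : component w k f ∈ quasiHomogeneous K w k := by
  rw [mem_quasiHomogeneous_iff]
  intro α hα
  by_contra h
  exact hα (by simp [component, coeff_apply, h])

theorem vfComponent_mem_vfGrad {K : Type*} [Field K] {n : ℕ} (w : Weighting n) (k : ℤ)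
    (X : FormalVectorField K n) : vfComponent w k X ∈ vfGrad K w k := by
  classical
  refine Submodule.sum_mem _ fun i _ => ?_
  intro l f hf
  have hc := (mem_quasiHomogeneous_iff w _ _).1
    (component_mem w (w.weight i + k) (X (MvPowerSeries.X i)))
  rw [mem_quasiHomogeneous_iff] at hf ⊢
  intro α hα
  rw [Derivation.smul_apply, smul_eq_mul, coeff_mul] at hα
  obtain ⟨⟨β, γ⟩, hβγ, hne⟩ := Finset.exists_ne_zero_of_sum_ne_zero hα
  have h1 := hc β (left_ne_zero_of_mul hne)
  have h2 := right_ne_zero_of_mul hne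
  simp only [coeff_pderiv] at h2
  have h3 := hf _ (left_ne_zero_of_mul h2)
  rw [w.degree_add, w.degree_single] at h3
  rw [← Finset.HasAntidiagonal.mem_antidiagonal.1 hβγ, w.degree_add]
  linarith

/-- The operator `ad_Y = ⁅Y, ·⁆` on quasi-homogeneous vector fields of weighted degree `k`, for `Y`
of weighted degree `0`. -/
def adGrad {K : Type*} [Field K] {n : ℕ} (w : Weighting n) (Y : vfGrad K w 0) (k : ℤ) :
    vfGrad K w k →ₗ[K] vfGrad K w k :=
  (LieAlgebra.ad K (FormalVectorField K n) (Y : FormalVectorField K n)).restrict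
    fun U hU l f hf => by
      rw [LieAlgebra.ad_apply, Derivation.commutator_apply]
      have h1 := Y.2 (l + k) _ (hU l f hf)
      have h2 := hU (l + 0) _ (Y.2 l f hf)
      rw [add_zero] at h1 h2
      exact Submodule.sub_mem _ h1 h2

end FormalGeometry

end

/-!
Write `D` for the weighted linear approximation of `X`. The sought diffeomorphism is obtained
degree by degree, as a solution of `D ∘ φ = φ ∘ X`, with no use of exponentials of vector fields.

Every difference `D ∘ φ - φ ∘ X` is a derivation along `φ`, so it is controlled by its values on the
coordinates, the `defect` of `φ`. For `φ = id` the defect in `xⁱ` lies in `𝓕^(wᵢ + 1)`. If the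
defect of `φ` in each `xⁱ` lies in `𝓕^(wᵢ + k)`, let `E ∈ 𝔛_[k]` be the vector field made of its
lowest parts, choose `Y ∈ 𝔛_[k]` with `⁅D, Y⁆ = -E`, and let `ψ` be the homomorphism with
`ψ(xⁱ) = φ(xⁱ) + Y(xⁱ)`. To leading order `ψ = φ + Y` (`algHom_sub_sub_derivation_mem_filt`), and
`X` agrees with `D` on the coordinates, so the defect changes by
`D(Y(xⁱ)) - Y(D(xⁱ)) = ⁅D, Y⁆(xⁱ)` modulo `𝓕^(wᵢ + k + 1)`: its lowest part cancels
(`exists_next`). The images of the coordinates converge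
in the weighted filtration (`exists_limit`), and the homomorphism they define has defect zero
(`exists_nearId_defect_eq_zero`). It is the identity plus terms of higher weighted degree, hence
bijective (`NearId.bijective`).

Vanishing of the defect means that `φ⁻¹ ∘ D ∘ φ` and `X` agree on the coordinates, and a derivation
of the power series ring is determined by its values there (`derivation_eq_of_X`). This, and the
estimates for homomorphisms, reduce to monomials by `map_mem_filt_of_monomial`, which depends on
the description of the ideals `𝓕^k` by coefficients (`mem_filt_iff`).
-/

namespace FormalGeometry

variable {K : Type*} [Field K] {n : ℕ} {w : Weighting n}

/-! ### The weighted filtration -/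

theorem Weighting.degree_nonneg (w : Weighting n) (α : Fin n →₀ ℕ) : 0 ≤ w.degree α :=
  Finset.sum_nonneg fun i _ => mul_nonneg (by linarith [w.one_le i]) (by positivity)

@[simp]
theorem Weighting.degree_zero (w : Weighting n) : w.degree 0 = 0 := by
  simp [Weighting.degree]

theorem monomial_mem_filt {α : Fin n →₀ ℕ} {k : ℤ} (h : k ≤ w.degree α) :
    monomial α (1 : K) ∈ filt K w k :=
  Ideal.subset_span ⟨α, h, rfl⟩

theorem X_mem_filt (w : Weighting n) (i : Fin n) :
    (MvPowerSeries.X i : FormalFunction K n) ∈ filt K w (w.weight i) :=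
  monomial_mem_filt (w.degree_single i).ge

theorem filt_antitone {k l : ℤ} (h : k ≤ l) : filt K w l ≤ filt K w k :=
  Ideal.span_mono fun _ ⟨α, hα, hf⟩ => ⟨α, h.trans hα, hf⟩

theorem mem_filt_of_nonpos {k : ℤ} (hk : k ≤ 0) (f : FormalFunction K n) : f ∈ filt K w k := by
  have h : (1 : FormalFunction K n) ∈ filt K w k :=
    monomial_mem_filt (α := 0) (by simpa using hk)
  simpa using Ideal.mul_mem_left _ f h

theorem mul_mem_filt {k l : ℤ} {f g : FormalFunction K n} (hf : f ∈ filt K w k)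
    (hg : g ∈ filt K w l) : f * g ∈ filt K w (k + l) := by
  have h : filt K w k * filt K w l ≤ filt K w (k + l) := by
    rw [filt, filt, Ideal.span_mul_span', Ideal.span_le]
    rintro _ ⟨_, ⟨α, hα, rfl⟩, _, ⟨β, hβ, rfl⟩, rfl⟩
    refine Ideal.subset_span ⟨α + β, by rw [w.degree_add]; lia, ?_⟩
    simp [monomial_mul_monomial]
  exact h (Ideal.mul_mem_mul hf hg)

theorem le_degree_of_mem_filt {k : ℤ} {f : FormalFunction K n} (hf : f ∈ filt K w k)
    (α : Fin n →₀ ℕ) (hα : coeff α f ≠ 0) : k ≤ w.degree α := by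
  induction hf using Submodule.span_induction generalizing α with
  | mem f hf =>
    obtain ⟨β, hβ, rfl⟩ := hf
    rwa [eq_of_coeff_monomial_ne_zero hα]
  | zero => simp at hα
  | add f g _ _ hf hg =>
    by_cases h : coeff α f = 0
    · exact hg α (by simpa [h] using hα)
    · exact hf α h
  | smul a f _ hf =>
    classical
    rw [smul_eq_mul, coeff_mul] at hα
    obtain ⟨⟨β, γ⟩, hβγ, hne⟩ := Finset.exists_ne_zero_of_sum_ne_zero hα
    rw [← Finset.HasAntidiagonal.mem_antidiagonal.1 hβγ, w.degree_add]
    linarith [w.degree_nonneg β, hf γ (right_ne_zero_of_mul hne)]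

/-- A power series without constant term can be written as `∑ i, xⁱ gᵢ`, where each monomial of
`xⁱ gᵢ` is a monomial of `f`: every nonconstant monomial of `f` is assigned to one of its
variables. -/
theorem exists_eq_sum_X_mul (f : FormalFunction K n) (hf : coeff 0 f = 0) :
    ∃ g : Fin n → FormalFunction K n, f = ∑ i, MvPowerSeries.X i * g i ∧
      ∀ i γ, coeff γ (g i) ≠ 0 → coeff (γ + Finsupp.single i 1) f ≠ 0 := by
  classical
  have hc : ∀ α : Fin n →₀ ℕ, ∃ c : Option (Fin n), α ≠ 0 → ∃ i, c = some i ∧ α i ≠ 0 := by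
    intro α
    by_cases h : α = 0
    · exact ⟨none, fun h' => absurd h h'⟩
    · obtain ⟨i, hi⟩ := Finsupp.ne_iff.1 h
      exact ⟨some i, fun _ => ⟨i, rfl, by simpa using hi⟩⟩
  choose c hc using hc
  let g : Fin n → FormalFunction K n := fun i γ =>
    if c (γ + Finsupp.single i 1) = some i then coeff (γ + Finsupp.single i 1) f else 0
  have hg : ∀ i γ, coeff γ (g i) =
      if c (γ + Finsupp.single i 1) = some i then coeff (γ + Finsupp.single i 1) f else 0 :=
    fun i γ => rfl
  refine ⟨g, ?_, fun i γ h => ?_⟩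
  · ext α
    simp only [map_sum, MvPowerSeries.X, coeff_monomial_mul, one_mul, hg]
    by_cases h : α = 0
    · subst h
      rw [hf, Finset.sum_eq_zero]
      intro i _
      rw [if_neg]
      intro h
      simpa using h i
    · obtain ⟨i, hi, hαi⟩ := hc α h
      have hle : Finsupp.single i 1 ≤ α := by
        rw [Finsupp.single_le_iff]; lia
      rw [Finset.sum_eq_single i]
      · rw [if_pos hle, tsub_add_cancel_of_le hle, if_pos hi]
      · intro j _ hj
        split_ifs with h1 h2
        · rw [tsub_add_cancel_of_le h1, hi] at h2
          exact absurd (Option.some.inj h2).symm hj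
        · rfl
        · rfl
      · simp
  · rw [hg] at h
    split_ifs at h
    · exact h
    · exact absurd rfl h

/-- The ideal `𝓕^k`, defined by finite sums of multiples of monomials, contains every infinite
combination of monomials of weighted degree at least `k`. -/
theorem mem_filt_iff {k : ℤ} {f : FormalFunction K n} :
    f ∈ filt K w k ↔ ∀ α, coeff α f ≠ 0 → k ≤ w.degree α := by
  refine ⟨le_degree_of_mem_filt, fun hf => ?_⟩
  suffices h : ∀ (m : ℕ) (k : ℤ), k ≤ m → ∀ f : FormalFunction K n,
      (∀ α, coeff α f ≠ 0 → k ≤ w.degree α) → f ∈ filt K w k from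
    h k.toNat k (Int.self_le_toNat k) f hf
  intro m
  induction m with
  | zero => exact fun k hk f _ => mem_filt_of_nonpos (by simpa using hk) f
  | succ m ih =>
    intro k hk f hf
    rcases le_or_gt k 0 with h0 | h0
    · exact mem_filt_of_nonpos h0 f
    · obtain ⟨g, hfg, hg⟩ := exists_eq_sum_X_mul f <| by
        by_contra h
        have := hf 0 h
        rw [w.degree_zero] at this
        lia
      rw [hfg]
      refine Ideal.sum_mem _ fun i _ => ?_
      have h1 := w.one_le i
      push_cast at hk
      have h2 := ih (k - w.weight i) (by lia) (g i) fun γ hγ => by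
        have := hf _ (hg i γ hγ)
        rw [w.degree_add, w.degree_single] at this
        lia
      simpa using mul_mem_filt (X_mem_filt w i) h2

theorem eq_zero_of_forall_mem_filt {f : FormalFunction K n} (h : ∀ k : ℕ, f ∈ filt K w k) :
    f = 0 := by
  ext α
  by_contra hα
  have := le_degree_of_mem_filt (h ((w.degree α).toNat + 1)) α hα
  push_cast at this
  have := Int.self_le_toNat (w.degree α)
  lia

theorem component_sub_mem_filt {k : ℤ} {f : FormalFunction K n} (hf : f ∈ filt K w k) :
    f - component w k f ∈ filt K w (k + 1) := by
  rw [mem_filt_iff]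
  intro α hα
  rw [map_sub] at hα
  have hc : coeff α (component w k f) = if w.degree α = k then coeff α f else 0 := rfl
  rw [hc] at hα
  split_ifs at hα with h
  · simp at hα
  · have := le_degree_of_mem_filt hf α (by simpa using hα)
    lia

theorem quasiHomogeneous_le_filt {k : ℤ} {f : FormalFunction K n}
    (hf : f ∈ quasiHomogeneous K w k) : f ∈ filt K w k :=
  mem_filt_iff.2 fun α hα => ((mem_quasiHomogeneous_iff w k f).1 hf α hα).ge

/-- The power series ring is complete for the weighted filtration. -/
theorem exists_limit {s : ℕ → FormalFunction K n} {c : ℤ}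
    (hs : ∀ k : ℕ, s (k + 1) - s k ∈ filt K w (k + c)) :
    ∃ t : FormalFunction K n, ∀ k : ℕ, t - s k ∈ filt K w (k + c) := by
  have hcauchy : ∀ k j : ℕ, k ≤ j → s j - s k ∈ filt K w (k + c) := by
    intro k j hkj
    induction j, hkj using Nat.le_induction with
    | base => simp
    | succ j hkj ih =>
      have := Ideal.add_mem _ (filt_antitone (by lia) (hs j)) ih
      simpa using this
  let N : (Fin n →₀ ℕ) → ℕ := fun α => (w.degree α - c + 1).toNat
  let t : FormalFunction K n := fun α => coeff α (s (N α))
  have ht : ∀ α, coeff α t = coeff α (s (N α)) := fun α => rfl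
  refine ⟨t, fun k => mem_filt_iff.2 fun α hα => ?_⟩
  rw [map_sub, ht] at hα
  by_contra! hlt
  apply hα
  rcases le_total k (N α) with h | h
  · by_contra hne
    have := le_degree_of_mem_filt (hcauchy _ _ h) α (by simpa using hne)
    lia
  · by_contra hne
    have := le_degree_of_mem_filt (hcauchy _ _ h) α
      (by rw [map_sub]; exact fun h => hne (by linear_combination -h))
    have := Int.self_le_toNat (w.degree α - c + 1)
    lia

/-! ### Linear maps, derivations and homomorphisms respecting the filtration -/

/-- A filtered linear map whose values on monomials rise by `k` in weighted degree raises the whole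
filtration by `k`: up to an element of arbitrarily high filtration, a power series is a finite
combination of its own monomials. -/
theorem map_mem_filt_of_monomial {T : FormalFunction K n →ₗ[K] FormalFunction K n} {k : ℤ}
    (hT : ∀ l : ℤ, ∀ f ∈ filt K w l, T f ∈ filt K w l)
    (hmon : ∀ α, T (monomial α 1) ∈ filt K w (w.degree α + k)) {l : ℤ} {f : FormalFunction K n}
    (hf : f ∈ filt K w l) : T f ∈ filt K w (l + k) := by
  classical
  have hfin : {α : Fin n →₀ ℕ | w.degree α < l + k}.Finite := by
    refine ((Set.finite_Ico 0 (l + k)).biUnion fun d _ => w.finite_degree_eq d).subset ?_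
    intro α hα
    simpa using ⟨w.degree_nonneg α, hα⟩
  let p : FormalFunction K n := ∑ α ∈ hfin.toFinset, coeff α f • monomial α (1 : K)
  have hp : f - p ∈ filt K w (l + k) := by
    rw [mem_filt_iff]
    intro α hα
    by_contra! h
    apply hα
    simp only [p, map_sub, map_sum, coeff_smul, coeff_monomial, mul_ite, mul_one, mul_zero]
    rw [Finset.sum_ite_eq, if_pos (by simpa using h), sub_self]
  have hTp : T p ∈ filt K w (l + k) := by
    simp only [p, map_sum, map_smul]
    refine Ideal.sum_mem _ fun α _ => ?_
    by_cases h : coeff α f = 0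
    · simp [h]
    · have h1 := le_degree_of_mem_filt hf α h
      exact Submodule.smul_of_tower_mem _ _ (filt_antitone (by lia) (hmon α))
  have := Ideal.add_mem _ (hT _ _ hp) hTp
  rwa [← map_add, sub_add_cancel] at this

theorem monomial_exponent_induction {p : (Fin n →₀ ℕ) → Prop} (h0 : p 0)
    (hX : ∀ i, p (Finsupp.single i 1)) (hadd : ∀ α β, p α → p β → p (α + β))
    (α : Fin n →₀ ℕ) : p α := by
  induction α using Finsupp.induction_linear with
  | zero => exact h0
  | add α β hα hβ => exact hadd α β hα hβ
  | single i m =>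
    induction m with
    | zero => simpa using h0
    | succ m ih => rw [Finsupp.single_add]; exact hadd _ _ ih (hX i)

theorem monomial_add_one (α β : Fin n →₀ ℕ) :
    monomial (α + β) (1 : K) = monomial α 1 * monomial β 1 := by
  simp [monomial_mul_monomial]

theorem derivation_mem_filt_of_monomial {D : FormalVectorField K n} {k : ℤ} (hk : 0 ≤ k)
    (hD : ∀ α, D (monomial α 1) ∈ filt K w (w.degree α + k)) {l : ℤ} {f : FormalFunction K n}
    (hf : f ∈ filt K w l) : D f ∈ filt K w (l + k) := by
  refine map_mem_filt_of_monomial (T := D.toLinearMap) (fun l f hf => ?_) hD hf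
  induction hf using Submodule.span_induction with
  | mem f hf =>
    obtain ⟨α, hα, rfl⟩ := hf
    exact filt_antitone (by lia) (hD α)
  | zero => simp
  | add f g _ _ hf hg => rw [map_add]; exact Ideal.add_mem _ hf hg
  | smul a f hf' hf =>
    change D (a * f) ∈ _
    rw [D.leibniz]
    exact Ideal.add_mem _ (Ideal.mul_mem_left _ _ hf) (Ideal.mul_mem_right _ _ hf')

theorem vfGrad_mem_filt {D : FormalVectorField K n} {k : ℤ} (hk : 0 ≤ k) (hD : D ∈ vfGrad K w k)
    {l : ℤ} {f : FormalFunction K n} (hf : f ∈ filt K w l) : D f ∈ filt K w (l + k) :=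
  derivation_mem_filt_of_monomial hk
    (fun α => quasiHomogeneous_le_filt (hD _ _ (Submodule.subset_span ⟨α, rfl, rfl⟩))) hf

/-- A formal vector field is determined by its coefficients. No continuity is assumed: a derivation
that kills the coordinates kills all monomials, hence preserves every ideal `𝓕^l`. -/
theorem derivation_eq_of_X (w : Weighting n) {D E : FormalVectorField K n}
    (h : ∀ i, D (MvPowerSeries.X i) = E (MvPowerSeries.X i)) : D = E := by
  rw [← sub_eq_zero]
  have hmon : ∀ α, (D - E) (monomial α (1 : K)) = 0 := by
    intro α
    induction α using monomial_exponent_induction with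
    | h0 => exact (D - E).map_one_eq_zero
    | hX i => exact sub_eq_zero.2 (h i)
    | hadd α β hα hβ => rw [monomial_add_one, (D - E).leibniz, hα, hβ]; simp
  ext1 f
  refine eq_zero_of_forall_mem_filt (w := w) fun k => ?_
  have h0 : f ∈ filt K w 0 := mem_filt_of_nonpos le_rfl f
  have := derivation_mem_filt_of_monomial (k := (k : ℤ)) (by positivity)
    (fun α => by rw [hmon]; exact Ideal.zero_mem _) h0
  rwa [zero_add] at this

theorem exists_algHom (w : Weighting n) {y : Fin n → FormalFunction K n}
    (hy : ∀ i, y i ∈ filt K w (w.weight i)) :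
    ∃ φ : FormalFunction K n →ₐ[K] FormalFunction K n, ∀ i, φ (MvPowerSeries.X i) = y i := by
  have hs : HasSubst y := hasSubst_of_constantCoeff_zero fun i => by
    rw [← coeff_zero_eq_constantCoeff_apply]
    by_contra h
    have h1 := le_degree_of_mem_filt (hy i) 0 h
    rw [w.degree_zero] at h1
    linarith [w.one_le i]
  exact ⟨substAlgHom hs, fun i => substAlgHom_X hs i⟩

variable {φ ψ : FormalFunction K n →ₐ[K] FormalFunction K n}

theorem algHom_mem_filt (hφ : ∀ i, φ (MvPowerSeries.X i) ∈ filt K w (w.weight i)) {l : ℤ}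
    {f : FormalFunction K n} (hf : f ∈ filt K w l) : φ f ∈ filt K w l := by
  have hmon : ∀ α, φ (monomial α 1) ∈ filt K w (w.degree α) := by
    intro α
    induction α using monomial_exponent_induction with
    | h0 => exact mem_filt_of_nonpos (by simp) _
    | hX i => rw [w.degree_single]; exact hφ i
    | hadd α β hα hβ =>
      rw [monomial_add_one, map_mul, w.degree_add]
      exact mul_mem_filt hα hβ
  induction hf using Submodule.span_induction with
  | mem f hf =>
    obtain ⟨α, hα, rfl⟩ := hf
    exact filt_antitone hα (hmon α)
  | zero => simp
  | add f g _ _ hf hg => rw [map_add]; exact Ideal.add_mem _ hf hg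
  | smul a f _ hf => rw [smul_eq_mul, map_mul]; exact Ideal.mul_mem_left _ _ hf

theorem algHom_sub_mem_filt (hφ : ∀ i, φ (MvPowerSeries.X i) ∈ filt K w (w.weight i))
    (hψ : ∀ i, ψ (MvPowerSeries.X i) ∈ filt K w (w.weight i)) {k : ℤ}
    (h : ∀ i, φ (MvPowerSeries.X i) - ψ (MvPowerSeries.X i) ∈ filt K w (w.weight i + k))
    {l : ℤ} {f : FormalFunction K n} (hf : f ∈ filt K w l) : φ f - ψ f ∈ filt K w (l + k) := by
  refine map_mem_filt_of_monomial (T := φ.toLinearMap - ψ.toLinearMap)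
    (fun l f hf => Ideal.sub_mem _ (algHom_mem_filt hφ hf) (algHom_mem_filt hψ hf)) ?_ hf
  intro α
  change φ _ - ψ _ ∈ _
  induction α using monomial_exponent_induction with
  | h0 =>
    change φ 1 - ψ 1 ∈ _
    simp
  | hX i => rw [w.degree_single]; exact h i
  | hadd α β hα hβ =>
    have h1 := mul_mem_filt hα (algHom_mem_filt hφ (monomial_mem_filt (le_refl (w.degree β))))
    have h2 := mul_mem_filt (algHom_mem_filt hψ (monomial_mem_filt (le_refl (w.degree α)))) hβ
    have h3 := Ideal.add_mem _ (filt_antitone (by rw [w.degree_add]; lia) h1)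
      (filt_antitone (k := w.degree (α + β) + k) (by rw [w.degree_add]; lia) h2)
    rw [monomial_add_one, map_mul, map_mul]
    convert h3 using 1
    ring

/-- A homomorphism is *near the identity* if it moves each coordinate by terms of weighted degree
larger than the weight of that coordinate. -/
def NearId (w : Weighting n) (φ : FormalFunction K n →ₐ[K] FormalFunction K n) : Prop :=
  ∀ i, φ (MvPowerSeries.X i) - MvPowerSeries.X i ∈ filt K w (w.weight i + 1)

theorem NearId.X_mem (hφ : NearId w φ) (i : Fin n) :
    φ (MvPowerSeries.X i) ∈ filt K w (w.weight i) := by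
  have := Ideal.add_mem _ (filt_antitone (by lia) (hφ i)) (X_mem_filt w i)
  rwa [sub_add_cancel] at this

theorem NearId.sub_mem (hφ : NearId w φ) {l : ℤ} {f : FormalFunction K n}
    (hf : f ∈ filt K w l) : φ f - f ∈ filt K w (l + 1) :=
  algHom_sub_mem_filt (ψ := AlgHom.id K _) hφ.X_mem (X_mem_filt w) hφ hf

/-- The formal inverse function theorem for homomorphisms near the identity; a preimage of `g` is
`∑ j, rⱼ` with `r₀ = g` and `rⱼ₊₁ = rⱼ - φ rⱼ`. -/
theorem NearId.bijective (hφ : NearId w φ) : Function.Bijective φ := by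
  constructor
  · rw [injective_iff_map_eq_zero]
    intro f hf
    refine eq_zero_of_forall_mem_filt (w := w) fun k => ?_
    induction k with
    | zero => exact mem_filt_of_nonpos (by simp) f
    | succ k ih =>
      have := hφ.sub_mem ih
      rw [hf, zero_sub, neg_mem_iff] at this
      exact_mod_cast this
  · intro g
    let r : ℕ → FormalFunction K n := fun j => (fun f => f - φ f)^[j] g
    have hr : ∀ j, r (j + 1) = r j - φ (r j) := fun j => Function.iterate_succ_apply' _ _ _
    have hrmem : ∀ j : ℕ, r j ∈ filt K w j := by
      intro j
      induction j with
      | zero => exact mem_filt_of_nonpos (by simp) _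
      | succ j ih =>
        rw [hr, ← neg_mem_iff, neg_sub]
        exact_mod_cast hφ.sub_mem ih
    obtain ⟨t, ht⟩ := exists_limit (s := fun N => ∑ j ∈ Finset.range N, r j) (c := 0) (w := w)
      fun k => by simpa [Finset.sum_range_succ] using hrmem k
    have hsum : ∀ N, φ (∑ j ∈ Finset.range N, r j) = g - r N := by
      intro N
      induction N with
      | zero => simp [r]
      | succ N ih => rw [Finset.sum_range_succ, map_add, ih, hr]; ring
    refine ⟨t, sub_eq_zero.1 (eq_zero_of_forall_mem_filt (w := w) fun k => ?_)⟩
    have h1 := algHom_mem_filt hφ.X_mem (ht k)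
    rw [add_zero, map_sub, hsum] at h1
    have h2 := Ideal.sub_mem _ h1 (hrmem k)
    convert h2 using 1
    ring

/-- Adding to a homomorphism near the identity a derivation `Y` of positive weighted degree `k` on
the coordinates adds `Y` to it everywhere, up to terms of higher weighted degree. -/
theorem algHom_sub_sub_derivation_mem_filt (hφ : NearId w φ) (hψ : NearId w ψ)
    {Y : FormalVectorField K n} {k : ℤ} (hk : 1 ≤ k) (hY : Y ∈ vfGrad K w k)
    (h : ∀ i, ψ (MvPowerSeries.X i) = φ (MvPowerSeries.X i) + Y (MvPowerSeries.X i))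
    {l : ℤ} {f : FormalFunction K n} (hf : f ∈ filt K w l) :
    ψ f - φ f - Y f ∈ filt K w (l + (k + 1)) := by
  refine map_mem_filt_of_monomial (T := ψ.toLinearMap - φ.toLinearMap - Y.toLinearMap)
    (fun l f hf => Ideal.sub_mem _
      (Ideal.sub_mem _ (algHom_mem_filt hψ.X_mem hf) (algHom_mem_filt hφ.X_mem hf))
      (filt_antitone (by lia) (vfGrad_mem_filt (by lia) hY hf))) ?_ hf
  intro α
  change ψ _ - φ _ - Y _ ∈ _
  induction α using monomial_exponent_induction with
  | h0 =>
    change ψ 1 - φ 1 - Y 1 ∈ _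
    simp
  | hX i =>
    change ψ (MvPowerSeries.X i) - φ (MvPowerSeries.X i) - Y (MvPowerSeries.X i) ∈ _
    simp [h]
  | hadd α β hα hβ =>
    have hmα : monomial α (1 : K) ∈ filt K w (w.degree α) := monomial_mem_filt le_rfl
    have hmβ : monomial β (1 : K) ∈ filt K w (w.degree β) := monomial_mem_filt le_rfl
    rw [monomial_add_one, map_mul, map_mul, Y.leibniz, w.degree_add, smul_eq_mul, smul_eq_mul]
    generalize monomial α (1 : K) = a at *
    generalize monomial β (1 : K) = b at *
    generalize w.degree α = p at *
    generalize w.degree β = q at *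
    have hYa := vfGrad_mem_filt (by lia) hY hmα
    have hYb := vfGrad_mem_filt (by lia) hY hmβ
    have h1 := mul_mem_filt (hφ.sub_mem hmα) hYb
    have h2 := mul_mem_filt hYa (hφ.sub_mem hmβ)
    have h3 := mul_mem_filt hYa hYb
    have h4 := mul_mem_filt hα (algHom_mem_filt hψ.X_mem hmβ)
    have h5 := mul_mem_filt
      (Ideal.add_mem _ (algHom_mem_filt hφ.X_mem hmα) (filt_antitone (by lia) hYa)) hβ
    have key : ψ a * ψ b - φ a * φ b - (a * Y b + b * Y a) =
        (φ a - a) * Y b + Y a * (φ b - b) + Y a * Y b + (ψ a - φ a - Y a) * ψ b +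
          (φ a + Y a) * (ψ b - φ b - Y b) := by ring
    rw [key]
    refine Ideal.add_mem _ (Ideal.add_mem _ (Ideal.add_mem _ (Ideal.add_mem _ ?_ ?_) ?_) ?_) ?_
    · exact filt_antitone (by lia) h1
    · exact filt_antitone (by lia) h2
    · exact filt_antitone (by lia) h3
    · exact filt_antitone (by lia) h4
    · exact filt_antitone (by lia) h5

/-! ### The conjugating diffeomorphism -/

theorem sum_smul_pderiv_X (e : Fin n → FormalFunction K n) (i : Fin n) :
    (∑ j, e j • pderiv K j : FormalVectorField K n) (MvPowerSeries.X i) = e i := by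
  classical
  have h := map_sum (Derivation.coeFnAddMonoidHom (R := K) (A := FormalFunction K n)
    (M := FormalFunction K n)) (fun j => e j • pderiv K j) Finset.univ
  change Derivation.coeFnAddMonoidHom _ _ = _
  rw [h, Finset.sum_apply, Finset.sum_eq_single i]
  · simp [pderiv_X_self]
  · intro j _ hj
    simp [pderiv_X_of_ne hj.symm]
  · simp

theorem vfComponent_X (w : Weighting n) (k : ℤ) (X : FormalVectorField K n) (i : Fin n) :
    vfComponent w k X (MvPowerSeries.X i) =
      component w (w.weight i + k) (X (MvPowerSeries.X i)) :=
  sum_smul_pderiv_X _ i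

/-- The defect of `φ` as a conjugation from `X` to `D`, in the coordinate `xⁱ`; it vanishes for
all `i` exactly when `D ∘ φ = φ ∘ X`. -/
noncomputable def defect (D X : FormalVectorField K n) (φ : FormalFunction K n →ₐ[K] FormalFunction K n)
    (i : Fin n) : FormalFunction K n :=
  D (φ (MvPowerSeries.X i)) - φ (X (MvPowerSeries.X i))

/-- One step of the normalization: a defect of relative degree `k` is removed up to relative degree
`k + 1` by adding to `φ` the solution `Y` of the cohomological equation that sets `⁅D, Y⁆` equal to
minus the lowest part of the defect. -/
theorem exists_next {X D : FormalVectorField K n} (hD : D ∈ vfGrad K w 0)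
    (hX : ∀ i, X (MvPowerSeries.X i) ∈ filt K w (w.weight i))
    (hXD : ∀ i, X (MvPowerSeries.X i) - D (MvPowerSeries.X i) ∈ filt K w (w.weight i + 1))
    {k : ℤ} (hk : 1 ≤ k) (hsurj : Function.Surjective (adGrad w ⟨D, hD⟩ k))
    (hφ : NearId w φ) (hdef : ∀ i, defect D X φ i ∈ filt K w (w.weight i + k)) :
    ∃ ψ : FormalFunction K n →ₐ[K] FormalFunction K n, NearId w ψ ∧
      (∀ i, defect D X ψ i ∈ filt K w (w.weight i + (k + 1))) ∧
      ∀ i, ψ (MvPowerSeries.X i) - φ (MvPowerSeries.X i) ∈ filt K w (w.weight i + k) := by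
  obtain ⟨⟨Y, hY⟩, hYeq⟩ := hsurj
    ⟨-vfComponent w k (∑ j, defect D X φ j • pderiv K j),
      neg_mem (vfComponent_mem_vfGrad w k _)⟩
  have hYmem : ∀ i, Y (MvPowerSeries.X i) ∈ filt K w (w.weight i + k) := fun i =>
    vfGrad_mem_filt (by lia) hY (X_mem_filt w i)
  have hbr : ∀ i, D (Y (MvPowerSeries.X i)) - Y (D (MvPowerSeries.X i)) =
      -component w (w.weight i + k) (defect D X φ i) := by
    intro i
    have h1 : ⁅D, Y⁆ = -vfComponent w k (∑ j, defect D X φ j • pderiv K j) :=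
      congrArg Subtype.val hYeq
    rw [← Derivation.commutator_apply, h1, Derivation.neg_apply, vfComponent_X, sum_smul_pderiv_X]
  obtain ⟨ψ, hψ⟩ := exists_algHom w (y := fun i => φ (MvPowerSeries.X i) + Y (MvPowerSeries.X i))
    fun i => Ideal.add_mem _ (hφ.X_mem i) (filt_antitone (by lia) (hYmem i))
  have hψid : NearId w ψ := fun i => by
    rw [hψ, add_sub_right_comm]
    exact Ideal.add_mem _ (hφ i) (filt_antitone (by lia) (hYmem i))
  refine ⟨ψ, hψid, fun i => ?_, fun i => by rw [hψ, add_sub_cancel_left]; exact hYmem i⟩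
  have h1 := component_sub_mem_filt (hdef i)
  have h2 := vfGrad_mem_filt (by lia) hY (hXD i)
  have h3 := algHom_sub_sub_derivation_mem_filt hφ hψid hk hY hψ (hX i)
  have key : defect D X ψ i =
      (defect D X φ i - component w (w.weight i + k) (defect D X φ i)) -
        Y (X (MvPowerSeries.X i) - D (MvPowerSeries.X i)) -
        (ψ (X (MvPowerSeries.X i)) - φ (X (MvPowerSeries.X i)) - Y (X (MvPowerSeries.X i))) := by
    rw [sub_eq_add_neg (defect D X φ i), ← hbr, map_sub, defect, defect, hψ, map_add]
    ring
  rw [key]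
  refine Ideal.sub_mem _ (Ideal.sub_mem _ ?_ ?_) ?_
  · exact filt_antitone (by lia) h1
  · exact filt_antitone (by lia) h2
  · exact filt_antitone (by lia) h3

/-- The corrections converge in the weighted filtration, and the limit has defect zero. -/
theorem exists_nearId_defect_eq_zero {X D : FormalVectorField K n} (hD : D ∈ vfGrad K w 0)
    (hX : ∀ i, X (MvPowerSeries.X i) ∈ filt K w (w.weight i))
    (hXD : ∀ i, X (MvPowerSeries.X i) - D (MvPowerSeries.X i) ∈ filt K w (w.weight i + 1))
    (hsurj : ∀ k : ℤ, 1 ≤ k → Function.Surjective (adGrad w ⟨D, hD⟩ k)) :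
    ∃ φ : FormalFunction K n →ₐ[K] FormalFunction K n, NearId w φ ∧ ∀ i, defect D X φ i = 0 := by
  -- The `k`-th approximation has a defect of relative degree `k + 1`.
  let S (k : ℕ) := {φ : FormalFunction K n →ₐ[K] FormalFunction K n //
    NearId w φ ∧ ∀ i, defect D X φ i ∈ filt K w (w.weight i + (k + 1))}
  have hnext : ∀ (k : ℕ) (φ : S k), ∃ ψ : S (k + 1), ∀ i,
      ψ.1 (MvPowerSeries.X i) - φ.1 (MvPowerSeries.X i) ∈ filt K w (w.weight i + (k + 1)) := by
    rintro k ⟨φ, hφ, hdef⟩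
    obtain ⟨ψ, h1, h2, h3⟩ := exists_next hD hX hXD (by lia) (hsurj (k + 1) (by lia)) hφ hdef
    exact ⟨⟨ψ, h1, fun i => by exact_mod_cast h2 i⟩, h3⟩
  choose next hnext using hnext
  let Φ : ∀ k, S k := fun k => Nat.rec ⟨AlgHom.id K _, fun i => by simp, fun i => by
    have := neg_mem (hXD i)
    rw [neg_sub] at this
    simpa [defect] using this⟩ next k
  have hΦ : ∀ (k : ℕ) i, (Φ (k + 1)).1 (MvPowerSeries.X i) - (Φ k).1 (MvPowerSeries.X i) ∈
      filt K w (k + (w.weight i + 1)) := fun k i =>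
    filt_antitone (by lia) (hnext k (Φ k) i)
  choose y hy using fun i =>
    exists_limit (s := fun k => (Φ k).1 (MvPowerSeries.X i)) fun k => hΦ k i
  have hy0 : ∀ i, y i - MvPowerSeries.X i ∈ filt K w (w.weight i + 1) := fun i =>
    filt_antitone (by lia) (hy i 0)
  obtain ⟨φ, hφ⟩ := exists_algHom w (y := y) fun i => by
    have := Ideal.add_mem _ (filt_antitone (by lia) (hy0 i)) (X_mem_filt w i)
    rwa [sub_add_cancel] at this
  have hφid : NearId w φ := fun i => by rw [hφ]; exact hy0 i
  refine ⟨φ, hφid, fun i => eq_zero_of_forall_mem_filt (w := w) fun k => ?_⟩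
  have hw := w.one_le i
  have hclose : ∀ j, φ (MvPowerSeries.X j) - (Φ k).1 (MvPowerSeries.X j) ∈
      filt K w (w.weight j + k) := fun j => by
    rw [hφ]; exact filt_antitone (by lia) (hy j k)
  have h1 := vfGrad_mem_filt le_rfl hD (hclose i)
  have h2 := algHom_sub_mem_filt hφid.X_mem (Φ k).2.1.X_mem hclose (hX i)
  have key : defect D X φ i = defect D X (Φ k).1 i +
      D (φ (MvPowerSeries.X i) - (Φ k).1 (MvPowerSeries.X i)) -
      (φ (X (MvPowerSeries.X i)) - (Φ k).1 (X (MvPowerSeries.X i))) := by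
    rw [defect, defect, map_sub]
    ring
  rw [key]
  refine Ideal.sub_mem _ (Ideal.add_mem _ ?_ ?_) ?_
  · exact filt_antitone (by lia) ((Φ k).2.2 i)
  · exact filt_antitone (by lia) h1
  · exact filt_antitone (by lia) h2

end FormalGeometry

theorem theorem4p2 {K : Type*} [Field K] [CharZero K] {n : ℕ}
    (w : FormalGeometry.Weighting n) (X : FormalGeometry.FormalVectorField K n)
    (hX : FormalGeometry.IsAdmissible w X)
    (hinv : ∀ k : ℤ, 1 ≤ k → Function.Bijective (FormalGeometry.adGrad w
      ⟨FormalGeometry.weightedLinearApprox w X, FormalGeometry.vfComponent_mem_vfGrad w 0 X⟩ k)) :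
    ∃ φ : FormalGeometry.FormalDiffeomorphism K n,
      FormalGeometry.pullback φ X = FormalGeometry.weightedLinearApprox w X := by
  have hXmem : ∀ i, X (MvPowerSeries.X i) ∈ FormalGeometry.filt K w (w.weight i) := fun i => by
    simpa using hX _ _ (FormalGeometry.X_mem_filt w i)
  obtain ⟨φ, hφ, hdef⟩ := FormalGeometry.exists_nearId_defect_eq_zero (X := X)
    (FormalGeometry.vfComponent_mem_vfGrad w 0 X) hXmem
    (fun i => by
      rw [FormalGeometry.vfComponent_X, add_zero]
      exact FormalGeometry.component_sub_mem_filt (hXmem i))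
    fun k hk => (hinv k hk).surjective
  let e : FormalGeometry.FormalDiffeomorphism K n := AlgEquiv.ofBijective φ hφ.bijective
  -- `X` and the pullback of the weighted linear approximation along `φ⁻¹` agree on coordinates.
  have h : X = FormalGeometry.pullback e.symm (FormalGeometry.weightedLinearApprox w X) := by
    refine FormalGeometry.derivation_eq_of_X w fun i => e.injective ?_
    change φ (X (MvPowerSeries.X i)) = e (e.symm (FormalGeometry.weightedLinearApprox w X
      (φ (MvPowerSeries.X i))))
    rw [AlgEquiv.apply_symm_apply]
    exact (sub_eq_zero.1 (hdef i)).symm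
  refine ⟨e, ?_⟩
  ext1 f
  change e (X (e.symm f)) = _
  rw [h]
  change e (e.symm (FormalGeometry.weightedLinearApprox w _ (e (e.symm f)))) = _
  rw [AlgEquiv.apply_symm_apply, AlgEquiv.apply_symm_apply, ← h]
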